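/- **Theorem 3.5.** Let $d\ge 3$, let $q_1,\dots,q_d$ be pairwise coprime positive integers, $\Gamma=q_1\mathbb Z\oplus\cdots\oplus q_d\mathbb Z$ and $Q=q_1\cdots q_d$. For a $\Gamma$-periodic function $V:\mathbb Z^d\to\mathbb C$ and $k\in\mathbb R^d$, let $D_V(k)$ be the $Q\times Q$ matrix which represents the operator $(\Delta u+Vu)(n)=\sum_{\|n'-n\|_1=1}u(n')+V(n)u(n)$ on the functions $u:\mathbb Z^d\to\mathbb C$ with $u(n+q_j\mathbf e_j)=e^{2\pi \mathbf i k_j}u(n)$ for all $n\in\mathbb Z^d$ and $1\le j\le d$, identified with their values on the fundamental domain $\prod_{j=1}^d\{0,\dots,q_j-1\}$; put $P_V(k,\lambda)=\det(D_V(k)-\lambda I)$. For $\lambda_1,\lambda_2\in\mathbb C$ and a non-empty set $S\subset\{1,\dots,d\}$, two such functions $V,Y$ are called *generalized partially Fermi isospectral* (with respect to $\lambda_1,\lambda_2,S$) if there are $k_j^*\in\mathbb R$, $j\notin S$, such that $P_V(k,\lambda_1)=P_Y(k,\lambda_2)$ for all $k\in\mathbb R^d$ with $k_j=k_j^*$ for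 every $j\notin S$. Let $r\ge 2$, $d_1,\dots,d_r\ge1$ and $d_1+\cdots+d_r=d$, and divide $\{1,\dots,d\}$ into the consecutive blocks $I_1,\dots,I_r$ of lengths $d_1,\dots,d_r$. A function $V$ on $\mathbb Z^d$ is called *$(d_1,\dots,d_r)$-separable* if there are functions $V_i:\mathbb Z^{d_i}\to\mathbb C$ with $V(n)=\sum_{i=1}^rV_i\big((n_j)_{j\in I_i}\big)$ for all $n\in\mathbb Z^d$. Let $V$ and $Y$ be real-valued $\Gamma$-periodic functions on $\mathbb Z^d$, and let $V$ be $(d_1,\dots,d_r)$-separable. Suppose that for all $1\le i<m\le r$, $s\in I_i$ and $t\in I_m$ there exist $\lambda_1=\lambda_1(s,t)\in\mathbb C$, $\lambda_2=\lambda_2(s,t)\in\mathbb C$ and $S=S(s,t)\subset\{1,\dots,d\}$ with $s,t\in S$ and $\#S\ge3$ such that $V$ and $Y$ are generalized partially Fermi isospectral with respect to $\lambda_1,\lambda_2,S$. Then $Y$ is also $(d_1,\dots,d_r)$-separable. -/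

import Mathlib

noncomputable section

/-- `V` is `Γ`-periodic, where `Γ = q₁ℤ ⊕ ⋯ ⊕ q_dℤ`. -/
def GammaPeriodic {d : ℕ} (q : Fin d → ℕ) (V : (Fin d → ℤ) → ℂ) : Prop :=
  ∀ (j : Fin d) (n : Fin d → ℤ), V (n + Pi.single j (q j : ℤ)) = V n

/-- The discrete Laplacian on functions on `ℤ^d`. The lattice points at `ℓ¹`-distance one from `n`
are exactly the `2d` points `n ± e_j`. -/
def discreteLaplacian {d : ℕ} (u : (Fin d → ℤ) → ℂ) (n : Fin d → ℤ) : ℂ :=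
  ∑ j : Fin d, (u (n + Pi.single j 1) + u (n - Pi.single j 1))

/-- The discrete Schrödinger operator `Δ + V`. -/
def schrodinger {d : ℕ} (V u : (Fin d → ℤ) → ℂ) (n : Fin d → ℤ) : ℂ :=
  discreteLaplacian u n + V n * u n

/-- The canonical representative in the fundamental domain `W = ∏ {0, …, q_j - 1}` of a class
modulo `Γ`. -/
def cellPoint {d : ℕ} (q : Fin d → ℕ) (m : (j : Fin d) → ZMod (q j)) : Fin d → ℤ :=
  fun j => ((m j).val : ℤ)

/-- The function on `ℤ^d` that has the values `w` on the fundamental domain `W` and satisfies the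
Floquet-Bloch boundary condition `u (n + q_j e_j) = exp (2πi k_j) u n` for every `j`; the division
is the floor division of integers. -/
def floquetExtension {d : ℕ} (q : Fin d → ℕ) (k : Fin d → ℝ)
    (w : ((j : Fin d) → ZMod (q j)) → ℂ) (n : Fin d → ℤ) : ℂ :=
  Complex.exp (2 * Real.pi * Complex.I * ∑ j : Fin d, (k j : ℂ) * ((n j / (q j : ℤ) : ℤ) : ℂ)) *
    w (fun j => (n j : ZMod (q j)))

/-- The `Q × Q` Floquet matrix `D_V(k)`, `Q = q₁ ⋯ q_d`, which represents `Δ + V` acting on the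
functions that satisfy the Floquet-Bloch boundary condition with quasi-momentum `k`. Its rows and
columns are indexed by the points of the fundamental domain, and the column of `m'` is the image
of the basis function of `m'`. -/
def floquetMatrix {d : ℕ} (q : Fin d → ℕ) (V : (Fin d → ℤ) → ℂ) (k : Fin d → ℝ) :
    Matrix ((j : Fin d) → ZMod (q j)) ((j : Fin d) → ZMod (q j)) ℂ :=
  Matrix.of fun m m' => schrodinger V (floquetExtension q k (Pi.single m' 1)) (cellPoint q m)

/-- `P_V(k, lam) = det (D_V(k) - lam I)`. -/
def floquetDet {d : ℕ} (q : Fin d → ℕ) [∀ j, NeZero (q j)] (V : (Fin d → ℤ) → ℂ)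
    (k : Fin d → ℝ) (lam : ℂ) : ℂ :=
  (floquetMatrix q V k - lam • (1 : Matrix _ _ ℂ)).det

/-- `V` and `Y` are generalized partially Fermi isospectral with respect to the energies `lam₁`,
`lam₂` and the nonempty set `S` of directions: for some fixed values of the quasi-momenta `k_j`,
`j ∉ S`, the identity `P_V(k, lam₁) = P_Y(k, lam₂)` holds for all real values of the remaining
quasi-momenta `k_j`, `j ∈ S`. -/
def GenPartiallyFermiIsospectral {d : ℕ} (q : Fin d → ℕ) [∀ j, NeZero (q j)]
    (V Y : (Fin d → ℤ) → ℂ) (lam₁ lam₂ : ℂ) (S : Finset (Fin d)) : Prop :=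
  S.Nonempty ∧ ∃ kstar : Fin d → ℝ, ∀ k : Fin d → ℝ, (∀ j, j ∉ S → k j = kstar j) →
    floquetDet q V k lam₁ = floquetDet q Y k lam₂

/-- `V` is `(d₁, …, d_r)`-separable. Here `c` is the composition `d = d₁ + ⋯ + d_r` into positive
parts, and `n ∘ c.embedding i` is the `i`-th block of consecutive coordinates of `n`. -/
def BlockSeparable {d : ℕ} (c : Composition d) (V : (Fin d → ℤ) → ℂ) : Prop :=
  ∃ U : (i : Fin c.length) → (Fin (c.blocksFun i) → ℤ) → ℂ,
    ∀ n : Fin d → ℤ, V n = ∑ i : Fin c.length, U i (n ∘ c.embedding i)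

end

/-!
The plane waves with quasi-momentum `k` turn `D_V(k)` into `diag (symbol) + convolution with V̂`,
where the symbol at the frequency `l` is the sum over `j` of `z_j ρ_j(l_j) + (z_j ρ_j(l_j))⁻¹`, with
`z_j = exp (2πi k_j / q_j)` and `ρ_j(a) = exp (2πi a / q_j)` (`floquetDet_eq`). Both determinants are
entire in `k`, so an isospectrality identity in the directions `S` holds for all nonzero complex
`z_j`, `j ∈ S` (`exists_det_eq_of_isospectral`).

A potential is separable exactly when its Fourier coefficients vanish at every frequency `m` with
nonzero components `m_s`, `m_t` in two different blocks. Fix such `s`, `t`, `m`, choose a third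
direction `u` in `S`, and put `x_j = ρ_j(m_j)`. By coprimality of the periods `x_s`, `x_t`, `x_u`
are distinct points of the unit circle. There is one line `ℂ w` on which the linear forms
`∑ ρ_j(l_j) z_j` (the sum over `j = s, t, u`) of the frequencies `l = 0` and `l = m` both vanish.
A form of another frequency that vanishes there is a combination of these two, that is, it comes
from an affine map taking three points of the unit circle to the unit circle; such a map is
constant or linear, and coprimality then gives `l = 0` or `l = m` at `s`, `t`, `u`
(`eq_or_proportional_of_norm_eq_one`).

Now let `z = τ w + y` with `τ → ∞`. The diagonal entries of all other frequencies blow up, so in the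
limit only the rows of the two classes `T₀` (`l = 0` at `s`, `t`, `u`) and `T₁` (`l = m` there)
remain, with arbitrary diagonal shifts `β` on `T₀` and `α` on `T₁` at our disposal through `y`
(`det_diagonal_add_rowTrunc_eq`). Determinants with arbitrary shifts determine the traces of the
squares of the blocks on `T₀ ∪ T₁`, `T₀` and `T₁`, hence the sum of `V̂(l - l') V̂(l' - l)` over
`l ∈ T₀`, `l' ∈ T₁` (`sum_mul_opposite_eq`). This sum is zero for the separable `V`; for the
real-valued `Y` it is the sum of `|Ŷ(l' - l)|²`, which contains `|Ŷ(m)|²`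
(`latticeFourier_eq_zero_of_isospectral`).
-/

open Matrix Filter Topology Finset

noncomputable section

/-! ### Recovering traces from determinants -/

/-- The values `det (σ + K)` determine the trace of `K²`, because
`det (σ² - K²) = det (σ - K) det (σ + K)` determines the characteristic polynomial of `K²`. -/
theorem trace_mul_self_eq_of_det_eq {n : Type*} [Fintype n] [DecidableEq n] {K L : Matrix n n ℂ}
    (h : ∀ σ : ℂ, (σ • (1 : Matrix n n ℂ) + K).det = (σ • (1 : Matrix n n ℂ) + L).det) :
    (K * K).trace = (L * L).trace := by
  have key : ∀ (M : Matrix n n ℂ) (σ : ℂ), (scalar n (σ ^ 2) - M * M).det =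
      (-1) ^ Fintype.card n * ((-σ) • (1 : Matrix n n ℂ) + M).det * (σ • 1 + M).det := by
    intro M σ
    rw [← det_neg, ← det_mul]
    congr 1
    simp only [scalar_apply, ← smul_one_eq_diagonal]
    noncomm_ring
    simp [smul_smul, add_comm]
  have hc : (K * K).charpoly = (L * L).charpoly := by
    refine Polynomial.funext fun t => ?_
    obtain ⟨σ, rfl⟩ := IsSquare.exists_sq t (IsAlgClosed.exists_eq_mul_self t)
    rw [eval_charpoly, eval_charpoly, key, key, h, h]
  rw [trace_eq_sum_roots_charpoly, trace_eq_sum_roots_charpoly, hc]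

/-! ### Letting some diagonal entries tend to infinity -/

/-- The matrix `K` with the rows outside `T` replaced by zero. -/
def rowTrunc {n : Type*} [DecidableEq n] (T : Finset n) (K : Matrix n n ℂ) : Matrix n n ℂ :=
  Matrix.of fun i j => if i ∈ T then K i j else 0

/-- If `diag D + K` and `diag D + L` have equal determinants along a family of diagonals `D` which
converges on `T` and blows up outside `T`, then the rows outside `T` can be removed from `K` and
`L`: divide each of these rows by its diagonal entry and pass to the limit. The values of the limit
diagonal `e` outside `T` only scale both determinants. -/
theorem det_diagonal_add_rowTrunc_eq {n : Type*} [Fintype n] [DecidableEq n]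
    {K L : Matrix n n ℂ} (T : Finset n) (D : ℝ → n → ℂ) (e : n → ℂ)
    (hT : ∀ i ∈ T, Tendsto (fun τ => D τ i) atTop (𝓝 (e i)))
    (hT' : ∀ i ∉ T, Tendsto (fun τ => ‖D τ i‖) atTop atTop)
    (hdet : ∀ᶠ τ in atTop, (diagonal (D τ) + K).det = (diagonal (D τ) + L).det) :
    (diagonal e + rowTrunc T K).det = (diagonal e + rowTrunc T L).det := by
  set v : ℝ → n → ℂ := fun τ i => if i ∈ T then 1 else e i * (D τ i)⁻¹ with hv
  have hinv : ∀ i ∉ T, Tendsto (fun τ => (D τ i)⁻¹) atTop (𝓝 0) := fun i hi =>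
    (tendsto_inv₀_cobounded).comp (tendsto_norm_atTop_iff_cobounded.1 (hT' i hi))
  have key : ∀ M : Matrix n n ℂ, Tendsto (fun τ => (∏ i, v τ i) * (diagonal (D τ) + M).det) atTop
      (𝓝 (diagonal e + rowTrunc T M).det) := by
    intro M
    simp_rw [← det_mul_column]
    have hcont : Continuous fun A : Matrix n n ℂ => A.det := continuous_id.matrix_det
    refine (hcont.tendsto (diagonal e + rowTrunc T M)).comp ?_
    refine tendsto_pi_nhds.2 fun i => tendsto_pi_nhds.2 fun j => ?_
    by_cases hi : i ∈ T
    · simp only [hv, of_apply, hi, if_true, one_mul, Matrix.add_apply, rowTrunc]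
      refine Tendsto.add_const _ ?_
      by_cases hij : i = j
      · subst hij
        simpa using hT i hi
      · simp [hij]
    · simp only [hv, of_apply, hi, if_false, Matrix.add_apply, rowTrunc, add_zero]
      have hM : Tendsto (fun τ => e i * (D τ i)⁻¹ * M i j) atTop (𝓝 0) := by
        simpa using ((hinv i hi).const_mul (e i)).mul_const (M i j)
      by_cases hij : i = j
      · subst hij
        have h0 : ∀ᶠ τ in atTop, D τ i ≠ 0 := by
          filter_upwards [(hT' i hi).eventually_gt_atTop 0] with τ hτ
          exact norm_pos_iff.1 hτ
        have := hM.const_add (e i)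
        rw [add_zero] at this
        simp only [diagonal_apply_eq]
        refine this.congr' ?_
        filter_upwards [h0] with τ hτ
        field_simp
      · simpa [hij] using hM
  refine tendsto_nhds_unique (key K) ((key L).congr' ?_)
  filter_upwards [hdet] with τ hτ
  rw [hτ]

theorem trace_mul_self_rowTrunc {n : Type*} [Fintype n] [DecidableEq n] (T : Finset n)
    (K : Matrix n n ℂ) :
    (rowTrunc T K * rowTrunc T K).trace = ∑ i ∈ T, ∑ j ∈ T, K i j * K j i := by
  simp only [trace, diag_apply, Matrix.mul_apply, rowTrunc, of_apply]
  rw [← Finset.sum_subset (Finset.subset_univ T) fun i _ hi => by simp [hi]]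
  refine Finset.sum_congr rfl fun i hi => ?_
  rw [← Finset.sum_subset (Finset.subset_univ T) fun j _ hj => by simp [hj]]
  exact Finset.sum_congr rfl fun j hj => by simp [hi, hj]

/-- Suppose that the determinants of the truncations of `diag e + K` and `diag e + L` to the rows
in `T₀ ∪ T₁` agree whenever `e - c` is constant on `T₀` and constant on `T₁`. Then `K` and `L`
have the same sum of products of opposite entries between `T₀` and `T₁`. Equal constants
determine the sum of such products over all pairs in `T₀ ∪ T₁`, and sending one of the constants
to infinity determines the sums over the pairs in `T₀` and over the pairs in `T₁`. -/
theorem sum_mul_opposite_eq {n : Type*} [Fintype n] [DecidableEq n] {K L : Matrix n n ℂ}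
    {T₀ T₁ : Finset n} (hT : Disjoint T₀ T₁) (c : n → ℂ)
    (h : ∀ (α β : ℂ) (e : n → ℂ), (∀ i ∈ T₀, e i = β + c i) → (∀ i ∈ T₁, e i = α + c i) →
      (diagonal e + rowTrunc (T₀ ∪ T₁) K).det = (diagonal e + rowTrunc (T₀ ∪ T₁) L).det) :
    ∑ i ∈ T₀, ∑ j ∈ T₁, K i j * K j i = ∑ i ∈ T₀, ∑ j ∈ T₁, L i j * L j i := by
  have htr : ∀ T : Finset n, (∀ σ : ℂ,
      (diagonal (fun i => if i ∈ T then σ + c i else σ) + rowTrunc T K).det =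
        (diagonal (fun i => if i ∈ T then σ + c i else σ) + rowTrunc T L).det) →
      ∑ i ∈ T, ∑ j ∈ T, (K + diagonal c) i j * (K + diagonal c) j i =
        ∑ i ∈ T, ∑ j ∈ T, (L + diagonal c) i j * (L + diagonal c) j i := by
    intro T hσ
    rw [← trace_mul_self_rowTrunc, ← trace_mul_self_rowTrunc]
    have hsplit : ∀ (M : Matrix n n ℂ) (σ : ℂ),
        σ • (1 : Matrix n n ℂ) + rowTrunc T (M + diagonal c) =
          diagonal (fun i => if i ∈ T then σ + c i else σ) + rowTrunc T M := by
      intro M σ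
      ext i j
      by_cases hi : i ∈ T <;> by_cases hij : i = j <;>
        simp [rowTrunc, hi, hij, diagonal_apply] <;> grind
    refine trace_mul_self_eq_of_det_eq fun σ => ?_
    rw [hsplit, hsplit, hσ]
  have hone : ∀ T T' : Finset n, Disjoint T T' →
      (∀ (α β : ℂ) (e : n → ℂ), (∀ i ∈ T, e i = β + c i) → (∀ i ∈ T', e i = α + c i) →
      (diagonal e + rowTrunc (T ∪ T') K).det = (diagonal e + rowTrunc (T ∪ T') L).det) →
      ∀ σ : ℂ, (diagonal (fun i => if i ∈ T then σ + c i else σ) + rowTrunc T K).det =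
        (diagonal (fun i => if i ∈ T then σ + c i else σ) + rowTrunc T L).det := by
    intro T T' hTT' h' σ
    have hrow : ∀ M : Matrix n n ℂ, rowTrunc T'ᶜ (rowTrunc (T ∪ T') M) = rowTrunc T M := by
      intro M
      ext i j
      have : i ∈ T → i ∉ T' := fun hi => Finset.disjoint_left.1 hTT' hi
      by_cases hi : i ∈ T <;> by_cases hi' : i ∈ T' <;> simp_all [rowTrunc]
    rw [← hrow K, ← hrow L]
    refine det_diagonal_add_rowTrunc_eq T'ᶜ
      (fun τ i => if i ∈ T' then (τ : ℂ) + c i else if i ∈ T then σ + c i else σ) _ ?_ ?_ ?_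
    · intro i hi
      simp only [Finset.mem_compl] at hi
      simp only [hi, if_false]
      exact tendsto_const_nhds
    · intro i hi
      simp only [Finset.mem_compl, not_not] at hi
      simp only [hi, if_true]
      rw [tendsto_norm_atTop_iff_cobounded]
      refine (tendsto_add_const_cobounded (c i)).comp ?_
      rw [← tendsto_norm_atTop_iff_cobounded]
      simpa using tendsto_abs_atTop_atTop
    · refine Eventually.of_forall fun τ => h' τ σ _ ?_ ?_
      · intro i hi
        simp [hi, Finset.disjoint_left.1 hTT' hi]
      · intro i hi
        simp [hi]
  have h01 := htr (T₀ ∪ T₁) fun σ => h σ σ _ (fun i hi => by simp [hi]) (fun i hi => by simp [hi])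
  have h0 := htr T₀ (hone T₀ T₁ hT h)
  have h1 := htr T₁ (hone T₁ T₀ hT.symm fun α β e he he' => by
    rw [Finset.union_comm]
    exact h β α e he' he)
  have hcross : ∀ M : Matrix n n ℂ,
      ∑ i ∈ T₀ ∪ T₁, ∑ j ∈ T₀ ∪ T₁, (M + diagonal c) i j * (M + diagonal c) j i =
        ∑ i ∈ T₀, ∑ j ∈ T₀, (M + diagonal c) i j * (M + diagonal c) j i +
        ∑ i ∈ T₁, ∑ j ∈ T₁, (M + diagonal c) i j * (M + diagonal c) j i +
        2 * ∑ i ∈ T₀, ∑ j ∈ T₁, M i j * M j i := by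
    intro M
    have hM : ∑ i ∈ T₀, ∑ j ∈ T₁, (M + diagonal c) i j * (M + diagonal c) j i =
        ∑ i ∈ T₀, ∑ j ∈ T₁, M i j * M j i := by
      refine Finset.sum_congr rfl fun i hi => Finset.sum_congr rfl fun j hj => ?_
      have hij : i ≠ j := fun hij => Finset.disjoint_left.1 hT hi (hij ▸ hj)
      simp [hij, hij.symm]
    have hM' : ∑ i ∈ T₁, ∑ j ∈ T₀, (M + diagonal c) i j * (M + diagonal c) j i =
        ∑ i ∈ T₀, ∑ j ∈ T₁, M i j * M j i := by
      rw [Finset.sum_comm, ← hM]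
      exact Finset.sum_congr rfl fun i _ => Finset.sum_congr rfl fun j _ => mul_comm _ _
    rw [Finset.sum_union hT]
    simp_rw [Finset.sum_union hT, Finset.sum_add_distrib]
    rw [hM, hM']
    ring
  rw [hcross, hcross, h0, h1] at h01
  simpa using h01


/-! ### Fourier analysis on the fundamental domain -/

/-- The character `n ↦ exp (2πi ∑ l_j n_j / q_j)` of `∏ ℤ/q_j` with frequency `l`. -/
def latticeChar {d : ℕ} {q : Fin d → ℕ} [∀ j, NeZero (q j)] (l n : (j : Fin d) → ZMod (q j)) : ℂ :=
  ∏ j, ZMod.stdAddChar (l j * n j)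

section
variable {d : ℕ} {q : Fin d → ℕ} [∀ j, NeZero (q j)]

theorem latticeChar_comm (l n : (j : Fin d) → ZMod (q j)) : latticeChar l n = latticeChar n l := by
  simp [latticeChar, mul_comm]

theorem latticeChar_add_left (l l' n : (j : Fin d) → ZMod (q j)) :
    latticeChar (l + l') n = latticeChar l n * latticeChar l' n := by
  simp [latticeChar, add_mul, AddChar.map_add_eq_mul, Finset.prod_mul_distrib]

theorem latticeChar_add_right (l n n' : (j : Fin d) → ZMod (q j)) :
    latticeChar l (n + n') = latticeChar l n * latticeChar l n' := by
  rw [latticeChar_comm, latticeChar_add_left, latticeChar_comm n, latticeChar_comm n']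

theorem latticeChar_neg_left (l n : (j : Fin d) → ZMod (q j)) :
    latticeChar (-l) n = latticeChar l (-n) := by
  simp [latticeChar]

theorem conj_latticeChar (l n : (j : Fin d) → ZMod (q j)) :
    (starRingEnd ℂ) (latticeChar l n) = latticeChar (-l) n := by
  simp [latticeChar, map_prod, ← AddChar.map_neg_eq_conj]

theorem latticeChar_single_right (l : (j : Fin d) → ZMod (q j)) (j : Fin d) (a : ZMod (q j)) :
    latticeChar l (Pi.single j a) = ZMod.stdAddChar (l j * a) := by
  rw [latticeChar, Finset.prod_eq_single j]
  · simp
  · intro i _ hi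
    simp [Pi.single_eq_of_ne hi]
  · simp

theorem sum_latticeChar (l : (j : Fin d) → ZMod (q j)) :
    ∑ n, latticeChar l n = if l = 0 then ∏ j, (q j : ℂ) else 0 := by
  have h : ∑ n, latticeChar l n = ∏ j, ∑ a : ZMod (q j), (ZMod.stdAddChar (l j * a) : ℂ) := by
    rw [Finset.prod_univ_sum, Fintype.piFinset_univ]
    rfl
  have h' : ∀ j, ∑ a : ZMod (q j), (ZMod.stdAddChar (l j * a) : ℂ) =
      if l j = 0 then (q j : ℂ) else 0 := by
    intro j
    simp_rw [mul_comm (l j)]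
    rw [AddChar.sum_mulShift _ (ZMod.isPrimitive_stdAddChar (q j))]
    simp [ZMod.card]
  rw [h]
  simp_rw [h']
  split_ifs with hl
  · simp [hl]
  · obtain ⟨j, hj⟩ := Function.ne_iff.1 hl
    exact Finset.prod_eq_zero (Finset.mem_univ j) (if_neg hj)

end

/-- The Fourier coefficient at the frequency `m` of the restriction of `V` to the fundamental
domain, normalised by `1 / Q`. -/
def latticeFourier {d : ℕ} (q : Fin d → ℕ) [∀ j, NeZero (q j)] (V : (Fin d → ℤ) → ℂ)
    (m : (j : Fin d) → ZMod (q j)) : ℂ :=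
  (∏ j, (q j : ℂ))⁻¹ * ∑ n, V (cellPoint q n) * latticeChar (-m) n

/-- The symbol of the discrete Laplacian at the frequency `l`, as a function of the
multipliers `z_j = exp (2πi k_j / q_j)`, which may be any nonzero complex numbers. -/
def laplaceSymbol {d : ℕ} {q : Fin d → ℕ} [∀ j, NeZero (q j)] (z : Fin d → ℂ)
    (l : (j : Fin d) → ZMod (q j)) : ℂ :=
  ∑ j, (z j * ZMod.stdAddChar (l j) + (z j * ZMod.stdAddChar (l j))⁻¹)

/-- The matrix of convolution with the Fourier coefficients of `V`, minus the energy `lam`. -/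
def fourierMatrix {d : ℕ} (q : Fin d → ℕ) [∀ j, NeZero (q j)] (V : (Fin d → ℤ) → ℂ) (lam : ℂ) :
    Matrix ((j : Fin d) → ZMod (q j)) ((j : Fin d) → ZMod (q j)) ℂ :=
  Matrix.of (fun l l' => latticeFourier q V (l - l')) - lam • 1

section
variable {d : ℕ} {q : Fin d → ℕ} [∀ j, NeZero (q j)]

theorem prod_period_ne_zero : (∏ j, (q j : ℂ)) ≠ 0 :=
  Finset.prod_ne_zero_iff.2 fun j _ => Nat.cast_ne_zero.2 (NeZero.ne (q j))

theorem sum_latticeFourier_mul (V : (Fin d → ℤ) → ℂ) (n : (j : Fin d) → ZMod (q j)) :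
    ∑ m, latticeFourier q V m * latticeChar m n = V (cellPoint q n) := by
  simp_rw [latticeFourier, mul_assoc, ← Finset.mul_sum, Finset.sum_mul]
  rw [Finset.sum_comm]
  have h : ∀ n' : (j : Fin d) → ZMod (q j),
      ∑ m, V (cellPoint q n') * latticeChar (-m) n' * latticeChar m n =
        V (cellPoint q n') * if n - n' = 0 then ∏ j, (q j : ℂ) else 0 := by
    intro n'
    rw [← sum_latticeChar, Finset.mul_sum]
    refine Finset.sum_congr rfl fun m _ => ?_
    rw [latticeChar_comm (n - n'), sub_eq_add_neg, latticeChar_add_right, latticeChar_neg_left]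
    ring
  simp_rw [h, sub_eq_zero]
  simp only [mul_ite, mul_zero, Finset.sum_ite_eq, Finset.mem_univ, if_true]
  field_simp [prod_period_ne_zero (q := q)]

theorem latticeFourier_neg {V : (Fin d → ℤ) → ℂ} (hV : ∀ n, (V n).im = 0)
    (m : (j : Fin d) → ZMod (q j)) :
    latticeFourier q V (-m) = (starRingEnd ℂ) (latticeFourier q V m) := by
  simp only [latticeFourier, map_mul, map_inv₀, map_prod, map_sum, conj_latticeChar,
    Complex.conj_natCast]
  congr 1
  refine Finset.sum_congr rfl fun n _ => ?_
  rw [Complex.conj_eq_iff_im.2 (hV _)]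

/-- A function on the fundamental domain which does not depend on the coordinate `s` has no
frequency `m` with `m s ≠ 0`. -/
theorem sum_mul_latticeChar_eq_zero {f : ((j : Fin d) → ZMod (q j)) → ℂ} {s : Fin d}
    (hf : ∀ n, f (n + Pi.single s 1) = f n) {m : (j : Fin d) → ZMod (q j)} (hm : m s ≠ 0) :
    ∑ n, f n * latticeChar m n = 0 := by
  have h : ∑ n, f n * latticeChar m n =
      (∑ n, f n * latticeChar m n) * ZMod.stdAddChar (m s) := by
    conv_lhs => rw [← Equiv.sum_comp
      (Equiv.addRight (Pi.single s (1 : ZMod (q s)) : (j : Fin d) → ZMod (q j)))]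
    rw [Finset.sum_mul]
    refine Finset.sum_congr rfl fun n _ => ?_
    simp only [Equiv.coe_addRight]
    rw [hf, latticeChar_add_right, latticeChar_single_right, mul_one, mul_assoc]
  have hne : (ZMod.stdAddChar (m s) : ℂ) ≠ 1 := fun h1 =>
    hm (ZMod.injective_stdAddChar (h1.trans (AddChar.map_zero_eq_one _).symm))
  by_contra h0
  exact hne (mul_left_cancel₀ h0 (by rw [mul_one]; exact h.symm))

/-! ### The Floquet determinant in the Fourier basis -/

theorem floquetMatrix_mulVec (V : (Fin d → ℤ) → ℂ) (k : Fin d → ℝ)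
    (w : ((j : Fin d) → ZMod (q j)) → ℂ) (m : (j : Fin d) → ZMod (q j)) :
    ∑ m', floquetMatrix q V k m m' * w m' =
      schrodinger V (floquetExtension q k w) (cellPoint q m) := by
  have hext : ∀ n, floquetExtension q k w n =
      ∑ m', floquetExtension q k (Pi.single m' 1) n * w m' := by
    intro n
    simp [floquetExtension, Pi.single_apply, mul_assoc]
  simp only [floquetMatrix, of_apply, schrodinger, discreteLaplacian, hext]
  simp only [add_mul, Finset.sum_mul, Finset.sum_add_distrib, Finset.mul_sum]
  congr 1
  · congr 1 <;> exact Finset.sum_comm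
  · exact Finset.sum_congr rfl fun _ _ => mul_assoc _ _ _

/-- The quasi-periodic plane wave with quasi-momentum `k` and frequency `l`. -/
def blochWave (q : Fin d → ℕ) [∀ j, NeZero (q j)] (k : Fin d → ℝ) (l : (j : Fin d) → ZMod (q j))
    (n : Fin d → ℤ) : ℂ :=
  Complex.exp (2 * Real.pi * Complex.I * ∑ j : Fin d, (k j : ℂ) * ((n j : ℂ) / q j)) *
    latticeChar l (fun j => (n j : ZMod (q j)))

theorem floquetExtension_blochWave (k : Fin d → ℝ) (l : (j : Fin d) → ZMod (q j)) :
    floquetExtension q k (fun m => blochWave q k l (cellPoint q m)) = blochWave q k l := by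
  funext n
  have hcast : (fun j => ((cellPoint q (fun j => (n j : ZMod (q j))) j : ℤ) : ZMod (q j))) =
      fun j => (n j : ZMod (q j)) := by
    funext j
    simp [cellPoint]
  simp only [floquetExtension, blochWave]
  rw [hcast, ← mul_assoc, ← Complex.exp_add, ← mul_add, ← Finset.sum_add_distrib]
  congr 4
  funext j
  rw [← mul_add]
  congr 1
  have hq : (q j : ℂ) ≠ 0 := Nat.cast_ne_zero.2 (NeZero.ne (q j))
  have hdiv : ((n j : ℤ) : ℂ) = ((q j : ℤ) * (n j / (q j : ℤ)) + n j % (q j : ℤ) : ℤ) := by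
    rw [Int.mul_ediv_add_emod]
  simp only [cellPoint, ZMod.val_intCast]
  conv_rhs => rw [hdiv]
  push_cast
  field_simp

theorem discreteLaplacian_blochWave (k : Fin d → ℝ) (l : (j : Fin d) → ZMod (q j))
    (n : Fin d → ℤ) :
    discreteLaplacian (blochWave q k l) n =
      laplaceSymbol (fun j => Complex.exp (2 * Real.pi * Complex.I * k j / q j)) l *
        blochWave q k l n := by
  have hadd : ∀ (n : Fin d → ℤ) (j : Fin d), blochWave q k l (n + Pi.single j 1) =
      Complex.exp (2 * Real.pi * Complex.I * k j / q j) * ZMod.stdAddChar (l j) *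
        blochWave q k l n := by
    intro n j
    have hcast : (fun i => (((n + Pi.single j 1 : Fin d → ℤ) i : ℤ) : ZMod (q i))) =
        (fun i => (n i : ZMod (q i))) + Pi.single j 1 := by
      funext i
      rcases eq_or_ne i j with rfl | hi
      · simp
      · simp [Pi.single_eq_of_ne hi]
    have hsum : ∑ i, (k i : ℂ) * ((((n + Pi.single j 1 : Fin d → ℤ) i : ℤ) : ℂ) / q i) =
        ∑ i, (k i : ℂ) * ((n i : ℂ) / q i) + k j / q j := by
      have : ∀ i, (k i : ℂ) * ((((n + Pi.single j 1 : Fin d → ℤ) i : ℤ) : ℂ) / q i) =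
          (k i : ℂ) * ((n i : ℂ) / q i) + if i = j then (k j : ℂ) / q j else 0 := by
        intro i
        rcases eq_or_ne i j with rfl | hi
        · simp; ring
        · simp [hi]
      simp_rw [this, Finset.sum_add_distrib]
      simp
    simp only [blochWave]
    rw [hcast, hsum, latticeChar_add_right, latticeChar_single_right, mul_add, Complex.exp_add,
      mul_one, mul_div_assoc]
    ring
  rw [discreteLaplacian, laplaceSymbol, Finset.sum_mul]
  refine Finset.sum_congr rfl fun j _ => ?_
  have hne : Complex.exp (2 * Real.pi * Complex.I * k j / q j) *
      (ZMod.stdAddChar (l j) : ℂ) ≠ 0 :=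
    mul_ne_zero (Complex.exp_ne_zero _) (AddChar.val_isUnit ZMod.stdAddChar (l j)).ne_zero
  have hsub := hadd (n - Pi.single j 1) j
  rw [sub_add_cancel] at hsub
  rw [hadd, add_mul, hsub, inv_mul_cancel_left₀ hne]

/-- In the basis of plane waves, `Δ + V` is the sum of the diagonal matrix of the symbol of the
Laplacian and of the convolution with the Fourier coefficients of `V`. -/
theorem floquetDet_eq (V : (Fin d → ℤ) → ℂ) (k : Fin d → ℝ) (lam : ℂ) :
    floquetDet q V k lam =
      (diagonal (laplaceSymbol fun j => Complex.exp (2 * Real.pi * Complex.I * k j / q j)) +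
        fourierMatrix q V lam).det := by
  set U : Matrix ((j : Fin d) → ZMod (q j)) ((j : Fin d) → ZMod (q j)) ℂ :=
    Matrix.of fun m l => blochWave q k l (cellPoint q m) with hU
  set X : Matrix ((j : Fin d) → ZMod (q j)) ((j : Fin d) → ZMod (q j)) ℂ :=
    Matrix.of fun m l => latticeChar l m with hX
  have hcell : ∀ m : (j : Fin d) → ZMod (q j),
      (fun j => ((cellPoint q m j : ℤ) : ZMod (q j))) = m := by
    intro m
    funext j
    simp [cellPoint]
  have hXdet : X.det ≠ 0 := by
    refine (Matrix.isUnit_det_of_right_inverse (B := Matrix.of fun l m =>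
      (∏ j, (q j : ℂ))⁻¹ * latticeChar (-l) m) ?_).ne_zero
    ext m m'
    simp only [hX, Matrix.mul_apply, of_apply]
    have : ∀ l : (j : Fin d) → ZMod (q j),
        latticeChar l m * ((∏ j, (q j : ℂ))⁻¹ * latticeChar (-l) m') =
        (∏ j, (q j : ℂ))⁻¹ * latticeChar (m - m') l := by
      intro l
      rw [latticeChar_comm (m - m'), sub_eq_add_neg, latticeChar_add_right, latticeChar_neg_left]
      ring
    simp_rw [this]
    rw [← Finset.mul_sum, sum_latticeChar, Matrix.one_apply]
    simp only [sub_eq_zero]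
    split_ifs
    · exact inv_mul_cancel₀ prod_period_ne_zero
    · simp
  have hUdet : U.det ≠ 0 := by
    have : U = Matrix.of fun m l => Complex.exp (2 * Real.pi * Complex.I *
        ∑ j : Fin d, (k j : ℂ) * ((cellPoint q m j : ℂ) / q j)) * X m l := by
      ext m l
      simp only [hU, hX, of_apply, blochWave]
      rw [hcell]
    rw [this, det_mul_column]
    exact mul_ne_zero (Finset.prod_ne_zero_iff.2 fun m _ => Complex.exp_ne_zero _) hXdet
  have hmul : (floquetMatrix q V k - lam • 1) * U = U *
      (diagonal (laplaceSymbol fun j => Complex.exp (2 * Real.pi * Complex.I * k j / q j)) +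
        fourierMatrix q V lam) := by
    rw [fourierMatrix, sub_mul, mul_add, mul_sub, ← add_sub_assoc]
    congr 1
    · ext m l
      rw [Matrix.add_apply, mul_diagonal, Matrix.mul_apply, Matrix.mul_apply]
      simp only [hU, of_apply]
      rw [floquetMatrix_mulVec, floquetExtension_blochWave, schrodinger,
        discreteLaplacian_blochWave, mul_comm (laplaceSymbol _ _)]
      congr 1
      rw [← sum_latticeFourier_mul V m, Finset.sum_mul]
      conv_rhs => rw [← Equiv.sum_comp (Equiv.addRight l)]
      refine Finset.sum_congr rfl fun m' _ => ?_
      simp only [Equiv.coe_addRight, add_sub_cancel_right, blochWave]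
      rw [hcell, latticeChar_add_left]
      ring
    · simp
  have := congrArg Matrix.det hmul
  rw [det_mul, det_mul, mul_comm] at this
  exact mul_left_cancel₀ hUdet this

end

/-! ### Complex quasi-momenta -/

/-- Two entire functions that agree at real points agree everywhere, also when only the
coordinates in `S` are free. -/
theorem eq_of_eq_on_real {d : ℕ} {F G : (Fin d → ℂ) → ℂ} (hF : Differentiable ℂ F)
    (hG : Differentiable ℂ G) (S : Finset (Fin d)) (kstar : Fin d → ℝ)
    (h : ∀ k : Fin d → ℝ, (∀ j, j ∉ S → k j = kstar j) →
      F (fun j => (k j : ℂ)) = G (fun j => (k j : ℂ)))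
    (κ : Fin d → ℂ) (hκ : ∀ j, j ∉ S → κ j = kstar j) : F κ = G κ := by
  suffices H : ∀ T : Finset (Fin d), ∀ κ : Fin d → ℂ, (∀ j, j ∉ S → κ j = kstar j) →
      (∀ j, j ∉ T → (κ j).im = 0) → F κ = G κ from
    H Finset.univ κ hκ fun j hj => absurd (Finset.mem_univ j) hj
  intro T
  induction T using Finset.induction_on with
  | empty =>
    intro κ hκ him
    have hre : κ = fun j => ((κ j).re : ℂ) := by
      funext j
      exact Complex.ext (by simp) (by simpa using him j)
    rw [hre]
    refine h _ fun j hj => ?_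
    rw [hκ j hj, Complex.ofReal_re]
  | insert a T ha ih =>
    intro κ hκ him
    by_cases haS : a ∈ S
    · have hupd : Differentiable ℂ fun ζ : ℂ => Function.update κ a ζ := by
        refine differentiable_pi.2 fun j => ?_
        rcases eq_or_ne j a with rfl | hj
        · simp
        · simp [Function.update_of_ne hj]
      have hF' : AnalyticOnNhd ℂ (fun ζ => F (Function.update κ a ζ)) Set.univ :=
        (hF.comp hupd).differentiableOn.analyticOnNhd isOpen_univ
      have hG' : AnalyticOnNhd ℂ (fun ζ => G (Function.update κ a ζ)) Set.univ :=
        (hG.comp hupd).differentiableOn.analyticOnNhd isOpen_univ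
      have hreal : ∀ x : ℝ, F (Function.update κ a x) = G (Function.update κ a x) := by
        intro x
        refine ih _ (fun j hj => ?_) fun j hj => ?_
        · rw [Function.update_of_ne (by rintro rfl; exact hj haS), hκ j hj]
        · rcases eq_or_ne j a with rfl | hja
          · simp
          · rw [Function.update_of_ne hja]
            exact him j (by simp [hja, hj])
      have hlim : Tendsto (fun n : ℕ => (((1 / ((n : ℝ) + 1) : ℝ)) : ℂ)) atTop (𝓝[≠] 0) := by
        refine tendsto_nhdsWithin_iff.2 ⟨?_, Eventually.of_forall fun n => ?_⟩
        · have := (Complex.continuous_ofReal.tendsto 0).comp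
            (tendsto_one_div_add_atTop_nhds_zero_nat (𝕜 := ℝ))
          simpa only [Complex.ofReal_zero, Function.comp_def] using this
        · have : (1 / ((n : ℝ) + 1) : ℝ) ≠ 0 := by positivity
          simpa only [Set.mem_compl_iff, Set.mem_singleton_iff, Complex.ofReal_eq_zero] using this
      have hfreq := hlim.frequently (p := fun ζ => F (Function.update κ a ζ) =
        G (Function.update κ a ζ)) (Frequently.of_forall fun n => hreal _)
      have := congrFun (AnalyticOnNhd.eq_of_frequently_eq hF' hG' hfreq) (κ a)
      simpa using this
    · refine ih κ hκ fun j hj => ?_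
      rcases eq_or_ne j a with rfl | hja
      · rw [hκ j haS, Complex.ofReal_im]
      · exact him j (by simp [hja, hj])

section
variable {d : ℕ} {q : Fin d → ℕ} [∀ j, NeZero (q j)]

theorem stdAddChar_ne_zero {N : ℕ} [NeZero N] (a : ZMod N) : (ZMod.stdAddChar a : ℂ) ≠ 0 :=
  (AddChar.val_isUnit ZMod.stdAddChar a).ne_zero

theorem norm_stdAddChar {N : ℕ} [NeZero N] (a : ZMod N) : ‖(ZMod.stdAddChar a : ℂ)‖ = 1 := by
  rw [ZMod.stdAddChar_apply, Circle.norm_coe]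

theorem differentiable_det_laplaceSymbol
    (M : Matrix ((j : Fin d) → ZMod (q j)) ((j : Fin d) → ZMod (q j)) ℂ) :
    Differentiable ℂ fun κ : Fin d → ℂ =>
      (diagonal (laplaceSymbol fun j => Complex.exp (2 * Real.pi * Complex.I * κ j / q j)) +
        M).det := by
  have hsym : ∀ l : (j : Fin d) → ZMod (q j), Differentiable ℂ fun κ : Fin d → ℂ =>
      laplaceSymbol (fun j => Complex.exp (2 * Real.pi * Complex.I * κ j / q j)) l := by
    intro l
    unfold laplaceSymbol
    refine Differentiable.fun_sum fun j _ => ?_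
    have h1 : Differentiable ℂ fun κ : Fin d → ℂ =>
        Complex.exp (2 * Real.pi * Complex.I * κ j / q j) * (ZMod.stdAddChar (l j) : ℂ) := by
      fun_prop
    exact h1.add (h1.fun_inv fun κ => mul_ne_zero (Complex.exp_ne_zero _) (stdAddChar_ne_zero _))
  simp only [det_apply']
  refine Differentiable.fun_sum fun σ _ => Differentiable.const_mul ?_ _
  refine fun κ => (HasFDerivAt.finsetProd fun i _ => DifferentiableAt.hasFDerivAt
    (?_ : DifferentiableAt ℂ _ κ)).differentiableAt
  simp only [Matrix.add_apply, diagonal_apply]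
  split_ifs with h
  · exact (hsym _ κ).add_const _
  · simp

/-- Partial isospectrality in the directions `S` gives an identity of determinants for all nonzero
complex multipliers in the directions of a subset `T` of `S`. The other quasi-momenta are fixed,
and their contribution `c` to the diagonal is the same for both potentials. -/
theorem exists_det_eq_of_isospectral {V Y : (Fin d → ℤ) → ℂ} {lam₁ lam₂ : ℂ} {S : Finset (Fin d)}
    (h : GenPartiallyFermiIsospectral q V Y lam₁ lam₂ S) {T : Finset (Fin d)} (hT : T ⊆ S) :
    ∃ c : ((j : Fin d) → ZMod (q j)) → ℂ, ∀ z : Fin d → ℂ, (∀ j ∈ T, z j ≠ 0) →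
      (diagonal (fun l => ∑ j ∈ T, (z j * ZMod.stdAddChar (l j) +
        (z j * ZMod.stdAddChar (l j))⁻¹) + c l) + fourierMatrix q V lam₁).det =
      (diagonal (fun l => ∑ j ∈ T, (z j * ZMod.stdAddChar (l j) +
        (z j * ZMod.stdAddChar (l j))⁻¹) + c l) + fourierMatrix q Y lam₂).det := by
  obtain ⟨-, kstar, hk⟩ := h
  refine ⟨fun l => ∑ j ∈ Tᶜ, (Complex.exp (2 * Real.pi * Complex.I * kstar j / q j) *
    ZMod.stdAddChar (l j) + (Complex.exp (2 * Real.pi * Complex.I * kstar j / q j) *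
    ZMod.stdAddChar (l j))⁻¹), fun z hz => ?_⟩
  -- Complex quasi-momenta whose multipliers are the given `z j` for `j ∈ T`.
  set κ : Fin d → ℂ := fun j =>
    if j ∈ T then q j * Complex.log (z j) / (2 * Real.pi * Complex.I) else kstar j with hκ
  have hexp : ∀ j ∈ T, Complex.exp (2 * Real.pi * Complex.I * κ j / q j) = z j := by
    intro j hj
    have hq : (q j : ℂ) ≠ 0 := Nat.cast_ne_zero.2 (NeZero.ne (q j))
    have hpi : (2 * Real.pi * Complex.I : ℂ) ≠ 0 := Complex.two_pi_I_ne_zero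
    rw [hκ]
    simp only [hj, if_true]
    rw [mul_div_cancel₀ _ hpi, mul_div_cancel_left₀ _ hq, Complex.exp_log (hz j hj)]
  have key := eq_of_eq_on_real (differentiable_det_laplaceSymbol (fourierMatrix q V lam₁))
    (differentiable_det_laplaceSymbol (fourierMatrix q Y lam₂)) S kstar
    (fun k hkS => by
      have := hk k hkS
      rwa [floquetDet_eq, floquetDet_eq] at this) κ
    (fun j hj => by
      have : j ∉ T := fun hjT => hj (hT hjT)
      simp [hκ, this])
  have hsym : (laplaceSymbol (q := q) fun j =>
      Complex.exp (2 * Real.pi * Complex.I * κ j / q j)) = fun l =>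
      ∑ j ∈ T, (z j * ZMod.stdAddChar (l j) + (z j * ZMod.stdAddChar (l j))⁻¹) +
        ∑ j ∈ Tᶜ, (Complex.exp (2 * Real.pi * Complex.I * kstar j / q j) *
        ZMod.stdAddChar (l j) + (Complex.exp (2 * Real.pi * Complex.I * kstar j / q j) *
        ZMod.stdAddChar (l j))⁻¹) := by
    funext l
    rw [laplaceSymbol, ← Finset.sum_add_sum_compl T]
    congr 1
    · exact Finset.sum_congr rfl fun j hj => by rw [hexp j hj]
    · refine Finset.sum_congr rfl fun j hj => ?_
      have : j ∉ T := Finset.mem_compl.1 hj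
      simp [hκ, this]
  rwa [hsym] at key

end

/-! ### Collinear triples of roots of unity -/

/-- Roots of unity of coprime orders coincide only if they are equal to one. -/
theorem eq_zero_of_stdAddChar_eq {M N : ℕ} [NeZero M] [NeZero N] (hMN : M.Coprime N) {a : ZMod M}
    {b : ZMod N} (h : (ZMod.stdAddChar a : ℂ) = ZMod.stdAddChar b) : a = 0 ∧ b = 0 := by
  have hpow : ∀ {N : ℕ} [NeZero N] (a : ZMod N), (ZMod.stdAddChar a : ℂ) ^ N = 1 := by
    intro N _ a
    rw [← AddChar.map_nsmul_eq_pow, nsmul_eq_mul, ZMod.natCast_self, zero_mul,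
      AddChar.map_zero_eq_one]
  have hone : (ZMod.stdAddChar a : ℂ) = 1 := by
    have := pow_gcd_eq_one.2 ⟨hpow a, (congrArg (· ^ N) h).trans (hpow b)⟩
    rwa [hMN.gcd_eq_one, pow_one] at this
  exact ⟨ZMod.injective_stdAddChar (hone.trans (AddChar.map_zero_eq_one _).symm),
    ZMod.injective_stdAddChar ((h.symm.trans hone).trans (AddChar.map_zero_eq_one _).symm)⟩

theorem stdAddChar_ne_of_coprime {M N : ℕ} [NeZero M] [NeZero N] (hMN : M.Coprime N) {a : ZMod M}
    {b : ZMod N} (ha : a ≠ 0) : (ZMod.stdAddChar a : ℂ) ≠ ZMod.stdAddChar b :=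
  fun h => ha (eq_zero_of_stdAddChar_eq hMN h).1

/-- If an affine map `α x + β` sends three distinct points of the unit circle to the unit circle,
then `α = 0` or `β = 0`. The vanishing of the determinant says that such a map takes `x` to `y`. -/
theorem eq_or_proportional_of_norm_eq_one {x₀ x₁ x₂ y₀ y₁ y₂ : ℂ}
    (hx₀ : ‖x₀‖ = 1) (hx₁ : ‖x₁‖ = 1) (hx₂ : ‖x₂‖ = 1)
    (hy₀ : ‖y₀‖ = 1) (hy₁ : ‖y₁‖ = 1) (hy₂ : ‖y₂‖ = 1)
    (h₀₁ : x₀ ≠ x₁) (h₁₂ : x₁ ≠ x₂) (h₀₂ : x₀ ≠ x₂)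
    (h : (x₁ - x₂) * y₀ + (x₂ - x₀) * y₁ + (x₀ - x₁) * y₂ = 0) :
    (y₀ = y₁ ∧ y₁ = y₂) ∨ (y₀ * x₁ = y₁ * x₀ ∧ y₁ * x₂ = y₂ * x₁) := by
  have hinv : ∀ {x : ℂ}, ‖x‖ = 1 → (starRingEnd ℂ) x = x⁻¹ := fun hx =>
    (Complex.inv_eq_conj hx).symm
  have hne : ∀ {x : ℂ}, ‖x‖ = 1 → x ≠ 0 := fun hx =>
    norm_ne_zero_iff.1 (by rw [hx]; exact one_ne_zero)
  -- The conjugate of the linear relation, with denominators cleared.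
  have hconj : (x₁ - x₂) * x₀ * (y₁ * y₂) + (x₂ - x₀) * x₁ * (y₀ * y₂) +
      (x₀ - x₁) * x₂ * (y₀ * y₁) = 0 := by
    have := congrArg (starRingEnd ℂ) h
    simp only [map_add, map_mul, map_sub, map_zero, hinv hx₀, hinv hx₁, hinv hx₂, hinv hy₀,
      hinv hy₁, hinv hy₂] at this
    have a0 := hne hx₀
    have a1 := hne hx₁
    have a2 := hne hx₂
    have b0 := hne hy₀
    have b1 := hne hy₁
    have b2 := hne hy₂
    field_simp at this
    linear_combination -this
  have d₀₁ : x₀ - x₁ ≠ 0 := sub_ne_zero.2 h₀₁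
  have d₁₂ : x₁ - x₂ ≠ 0 := sub_ne_zero.2 h₁₂
  have d₀₂ : x₀ - x₂ ≠ 0 := sub_ne_zero.2 h₀₂
  obtain ⟨α, hα⟩ : ∃ α, α * (x₀ - x₁) = y₀ - y₁ := ⟨(y₀ - y₁) / (x₀ - x₁), div_mul_cancel₀ _ d₀₁⟩
  obtain ⟨β, hβ⟩ : ∃ β, y₀ = α * x₀ + β := ⟨y₀ - α * x₀, by ring⟩
  have hβ₁ : y₁ = α * x₁ + β := by linear_combination hβ + hα
  have hβ₂ : y₂ = α * x₂ + β := by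
    apply mul_left_cancel₀ d₀₁
    rw [hβ, hβ₁] at h
    linear_combination h
  rw [hβ, hβ₁, hβ₂] at hconj
  have hprod : α * β * ((x₀ - x₁) * (x₁ - x₂) * (x₀ - x₂)) = 0 := by
    linear_combination -hconj
  have hαβ : α * β = 0 := by
    simpa [d₀₁, d₁₂, d₀₂] using hprod
  rcases mul_eq_zero.1 hαβ with h0 | h0
  · left
    rw [hβ, hβ₁, hβ₂, h0]
    simp
  · right
    rw [hβ, hβ₁, hβ₂, h0]
    constructor <;> ring

theorem tendsto_norm_mul_add_atTop {a b : ℂ} (ha : a ≠ 0) {g : ℝ → ℂ}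
    (hg : Tendsto g atTop (𝓝 b)) :
    Tendsto (fun τ : ℝ => ‖(τ : ℂ) * a + g τ‖) atTop atTop := by
  have h1 : Tendsto (fun τ : ℝ => τ * ‖a‖ + -‖g τ‖) atTop atTop :=
    (tendsto_id.atTop_mul_const (norm_pos_iff.2 ha)).atTop_add hg.norm.neg
  refine tendsto_atTop_mono (fun τ => ?_) h1
  have h2 : ‖(τ : ℂ) * a‖ ≤ ‖(τ : ℂ) * a + g τ‖ + ‖g τ‖ := by
    simpa using norm_sub_le ((τ : ℂ) * a + g τ) (g τ)
  rw [norm_mul, Complex.norm_real, Real.norm_eq_abs] at h2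
  have h3 : τ * ‖a‖ ≤ |τ| * ‖a‖ := mul_le_mul_of_nonneg_right (le_abs_self τ) (norm_nonneg a)
  linarith

section
variable {d : ℕ} {q : Fin d → ℕ} [∀ j, NeZero (q j)]

/-! ### Comparison of Fourier coefficients -/

/-- Along the line `z = τ w + y`, with all `w j ≠ 0`, the diagonal entries at the frequencies `l`
which annihilate the direction `w` converge and the others tend to infinity; only the rows of the
former remain in the limit. -/
theorem det_rowTrunc_eq_of_line
    {K L : Matrix ((j : Fin d) → ZMod (q j)) ((j : Fin d) → ZMod (q j)) ℂ}
    {T : Finset (Fin d)} {c : ((j : Fin d) → ZMod (q j)) → ℂ}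
    (h : ∀ z : Fin d → ℂ, (∀ j ∈ T, z j ≠ 0) →
      (diagonal (fun l => ∑ j ∈ T, (z j * ZMod.stdAddChar (l j) +
        (z j * ZMod.stdAddChar (l j))⁻¹) + c l) + K).det =
      (diagonal (fun l => ∑ j ∈ T, (z j * ZMod.stdAddChar (l j) +
        (z j * ZMod.stdAddChar (l j))⁻¹) + c l) + L).det)
    {w : Fin d → ℂ} (hw : ∀ j ∈ T, w j ≠ 0) (y : Fin d → ℂ)
    (R : Finset ((j : Fin d) → ZMod (q j)))
    (hR : ∀ l, l ∈ R ↔ ∑ j ∈ T, w j * (ZMod.stdAddChar (l j) : ℂ) = 0)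
    {e : ((j : Fin d) → ZMod (q j)) → ℂ}
    (he : ∀ l ∈ R, e l = ∑ j ∈ T, y j * (ZMod.stdAddChar (l j) : ℂ) + c l) :
    (diagonal e + rowTrunc R K).det = (diagonal e + rowTrunc R L).det := by
  have hline : ∀ j ∈ T, Tendsto (fun τ : ℝ => ‖(τ : ℂ) * w j + y j‖) atTop atTop := fun j hj =>
    tendsto_norm_mul_add_atTop (hw j hj) tendsto_const_nhds
  set g : ((j : Fin d) → ZMod (q j)) → ℝ → ℂ := fun l τ =>
    ∑ j ∈ T, (y j * ZMod.stdAddChar (l j) +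
      (((τ : ℂ) * w j + y j) * ZMod.stdAddChar (l j))⁻¹) + c l with hg
  have hgl : ∀ l, Tendsto (g l) atTop (𝓝 (∑ j ∈ T, y j * (ZMod.stdAddChar (l j) : ℂ) + c l)) := by
    intro l
    refine Tendsto.add_const _ (tendsto_finsetSum _ fun j hj => ?_)
    have hinv : Tendsto (fun τ : ℝ => (((τ : ℂ) * w j + y j) * (ZMod.stdAddChar (l j) : ℂ))⁻¹)
        atTop (𝓝 0) := by
      refine tendsto_inv₀_cobounded.comp (tendsto_norm_atTop_iff_cobounded.1 ?_)
      simpa [norm_stdAddChar] using hline j hj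
    simpa using hinv.const_add (y j * (ZMod.stdAddChar (l j) : ℂ))
  have hD : ∀ (l : (j : Fin d) → ZMod (q j)) (τ : ℝ),
      ∑ j ∈ T, (((τ : ℂ) * w j + y j) * ZMod.stdAddChar (l j) +
        (((τ : ℂ) * w j + y j) * ZMod.stdAddChar (l j))⁻¹) + c l =
      (τ : ℂ) * ∑ j ∈ T, w j * (ZMod.stdAddChar (l j) : ℂ) + g l τ := by
    intro l τ
    simp only [hg]
    rw [Finset.mul_sum, ← add_assoc, ← Finset.sum_add_distrib]
    congr 1
    exact Finset.sum_congr rfl fun j _ => by ring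
  refine det_diagonal_add_rowTrunc_eq R (fun τ l =>
    ∑ j ∈ T, (((τ : ℂ) * w j + y j) * ZMod.stdAddChar (l j) +
      (((τ : ℂ) * w j + y j) * ZMod.stdAddChar (l j))⁻¹) + c l) e ?_ ?_ ?_
  · intro l hl
    simp only [hD]
    rw [(hR l).1 hl, he l hl]
    simpa using hgl l
  · intro l hl
    simp only [hD]
    exact tendsto_norm_mul_add_atTop (fun h0 => hl ((hR l).2 h0)) (hgl l)
  · have hev : ∀ᶠ τ : ℝ in atTop, ∀ j ∈ T, (τ : ℂ) * w j + y j ≠ 0 := by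
      refine (Filter.eventually_all_finset T).2 fun j hj => ?_
      filter_upwards [(hline j hj).eventually_gt_atTop 0] with τ hτ
      exact norm_pos_iff.1 hτ
    filter_upwards [hev] with τ hτ
    exact h (fun j => (τ : ℂ) * w j + y j) hτ

/-- Partial isospectrality in three directions `s`, `t`, `u` transfers from `V` to `Y` the
vanishing of the Fourier coefficients at the frequencies `m` with `m s ≠ 0` and `m t ≠ 0`. The
multipliers are sent to infinity along the line which is annihilated by the frequencies `0`
and `m`: by coprimality, no frequency with other components at `s`, `t`, `u` annihilates it. -/
theorem latticeFourier_eq_zero_of_isospectral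
    (hq : ∀ i j : Fin d, i ≠ j → Nat.Coprime (q i) (q j)) {V Y : (Fin d → ℤ) → ℂ}
    (hY : ∀ n, (Y n).im = 0) {lam₁ lam₂ : ℂ} {S : Finset (Fin d)}
    (hiso : GenPartiallyFermiIsospectral q V Y lam₁ lam₂ S) {s t u : Fin d}
    (hs : s ∈ S) (ht : t ∈ S) (hu : u ∈ S) (hst : s ≠ t) (htu : t ≠ u) (hsu : s ≠ u)
    (hV : ∀ m : (j : Fin d) → ZMod (q j), m s ≠ 0 → m t ≠ 0 → latticeFourier q V m = 0)
    {m : (j : Fin d) → ZMod (q j)} (hms : m s ≠ 0) (hmt : m t ≠ 0) :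
    latticeFourier q Y m = 0 := by
  set T : Finset (Fin d) := {s, t, u} with hT
  have hTS : T ⊆ S := by
    intro j hj
    simp only [hT, Finset.mem_insert, Finset.mem_singleton] at hj
    rcases hj with rfl | rfl | rfl <;> assumption
  have hsum : ∀ f : Fin d → ℂ, ∑ j ∈ T, f j = f s + f t + f u := by
    intro f
    rw [hT, Finset.sum_insert (by simp [hst, hsu]), Finset.sum_pair htu, add_assoc]
  obtain ⟨c, hc⟩ := exists_det_eq_of_isospectral hiso hTS
  set xs : ℂ := ZMod.stdAddChar (m s) with hxs
  set xt : ℂ := ZMod.stdAddChar (m t) with hxt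
  set xu : ℂ := ZMod.stdAddChar (m u) with hxu
  have hxst : xs ≠ xt := stdAddChar_ne_of_coprime (hq s t hst) hms
  have hxsu : xs ≠ xu := stdAddChar_ne_of_coprime (hq s u hsu) hms
  have hxtu : xt ≠ xu := stdAddChar_ne_of_coprime (hq t u htu) hmt
  set w : Fin d → ℂ := fun j => if j = s then xt - xu else if j = t then xu - xs else xs - xt
    with hw
  have hws : w s = xt - xu := by simp [hw]
  have hwt : w t = xu - xs := by simp [hw, hst.symm]
  have hwu : w u = xs - xt := by simp [hw, hsu.symm, htu.symm]
  have hwne : ∀ j ∈ T, w j ≠ 0 := by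
    intro j hj
    simp only [hT, Finset.mem_insert, Finset.mem_singleton] at hj
    rcases hj with rfl | rfl | rfl
    · rw [hws]; exact sub_ne_zero.2 hxtu
    · rw [hwt]; exact sub_ne_zero.2 hxsu.symm
    · rw [hwu]; exact sub_ne_zero.2 hxst
  set T₀ : Finset ((j : Fin d) → ZMod (q j)) :=
    Finset.univ.filter fun l => l s = 0 ∧ l t = 0 ∧ l u = 0 with hT₀
  set T₁ : Finset ((j : Fin d) → ZMod (q j)) :=
    Finset.univ.filter fun l => l s = m s ∧ l t = m t ∧ l u = m u with hT₁
  have hmem₀ : ∀ l, l ∈ T₀ ↔ l s = 0 ∧ l t = 0 ∧ l u = 0 := by simp [hT₀]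
  have hmem₁ : ∀ l, l ∈ T₁ ↔ l s = m s ∧ l t = m t ∧ l u = m u := by simp [hT₁]
  have hdisj : Disjoint T₀ T₁ := Finset.disjoint_left.2 fun l h0 h1 =>
    hms (((hmem₁ l).1 h1).1.symm.trans ((hmem₀ l).1 h0).1)
  have hR : ∀ l, l ∈ T₀ ∪ T₁ ↔ ∑ j ∈ T, w j * (ZMod.stdAddChar (l j) : ℂ) = 0 := by
    intro l
    rw [hsum, hws, hwt, hwu, Finset.mem_union, hmem₀, hmem₁]
    constructor
    · rintro (⟨h1, h2, h3⟩ | ⟨h1, h2, h3⟩)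
      · rw [h1, h2, h3]
        simp only [AddChar.map_zero_eq_one]
        ring
      · rw [h1, h2, h3]
        ring
    · intro h0
      rcases eq_or_proportional_of_norm_eq_one (norm_stdAddChar (m s)) (norm_stdAddChar (m t))
        (norm_stdAddChar (m u)) (norm_stdAddChar (l s)) (norm_stdAddChar (l t))
        (norm_stdAddChar (l u)) hxst hxtu hxsu h0 with ⟨h1, h2⟩ | ⟨h1, h2⟩
      · left
        exact ⟨(eq_zero_of_stdAddChar_eq (hq s t hst) h1).1,
          eq_zero_of_stdAddChar_eq (hq t u htu) h2⟩
      · right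
        have hdiv : ∀ {i j : Fin d}, (ZMod.stdAddChar (l i) : ℂ) * ZMod.stdAddChar (m j) =
            ZMod.stdAddChar (l j) * ZMod.stdAddChar (m i) →
            (ZMod.stdAddChar (l i - m i) : ℂ) = ZMod.stdAddChar (l j - m j) := by
          intro i j hij
          rw [AddChar.map_sub_eq_div, AddChar.map_sub_eq_div,
            div_eq_div_iff (stdAddChar_ne_zero _) (stdAddChar_ne_zero _), hij]
        have e1 := eq_zero_of_stdAddChar_eq (hq s t hst) (hdiv h1)
        have e2 := eq_zero_of_stdAddChar_eq (hq t u htu) (hdiv h2)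
        exact ⟨sub_eq_zero.1 e1.1, sub_eq_zero.1 e2.1, sub_eq_zero.1 e2.2⟩
  -- Arbitrary shifts `β` on `T₀` and `α` on `T₁` are realised by the offset of the line.
  have hcross := sum_mul_opposite_eq (K := fourierMatrix q V lam₁) (L := fourierMatrix q Y lam₂)
    hdisj c fun α β e he₀ he₁ => by
      -- The offset `y` solves `y s + y t = β` and `xs * y s + xt * y t = α`, with `y u = 0`.
      set y : Fin d → ℂ := fun j => if j = s then (α - β * xt) / (xs - xt) else
        if j = t then (β * xs - α) / (xs - xt) else 0 with hy
      have hys : y s = (α - β * xt) / (xs - xt) := by simp [hy]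
      have hyt : y t = (β * xs - α) / (xs - xt) := by simp [hy, hst.symm]
      have hyu : y u = 0 := by simp [hy, hsu.symm, htu.symm]
      have hne : xs - xt ≠ 0 := sub_ne_zero.2 hxst
      refine det_rowTrunc_eq_of_line hc hwne y (T₀ ∪ T₁) hR fun l hl => ?_
      rw [hsum, hys, hyt, hyu]
      rcases Finset.mem_union.1 hl with hl | hl
      · rw [he₀ l hl]
        obtain ⟨h1, h2, h3⟩ := (hmem₀ l).1 hl
        rw [h1, h2, h3]
        simp only [AddChar.map_zero_eq_one]
        field_simp
        ring
      · rw [he₁ l hl]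
        obtain ⟨h1, h2, h3⟩ := (hmem₁ l).1 hl
        rw [h1, h2, h3, ← hxs, ← hxt]
        field_simp
        ring
  have hentry : ∀ (W : (Fin d → ℤ) → ℂ) (lam : ℂ), ∀ i ∈ T₀, ∀ j ∈ T₁,
      fourierMatrix q W lam i j * fourierMatrix q W lam j i =
        latticeFourier q W (-(j - i)) * latticeFourier q W (j - i) := by
    intro W lam i hi j hj
    have hij : i ≠ j := fun hij => Finset.disjoint_left.1 hdisj hi (hij ▸ hj)
    simp [fourierMatrix, hij, hij.symm]
  have hzero : ∑ i ∈ T₀, ∑ j ∈ T₁, fourierMatrix q V lam₁ i j * fourierMatrix q V lam₁ j i = 0 := by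
    refine Finset.sum_eq_zero fun i hi => Finset.sum_eq_zero fun j hj => ?_
    rw [hentry V lam₁ i hi j hj, hV (j - i), mul_zero]
    · rw [Pi.sub_apply, ((hmem₀ i).1 hi).1, ((hmem₁ j).1 hj).1, sub_zero]
      exact hms
    · rw [Pi.sub_apply, ((hmem₀ i).1 hi).2.1, ((hmem₁ j).1 hj).2.1, sub_zero]
      exact hmt
  rw [hzero] at hcross
  have hnorm : ∑ i ∈ T₀, ∑ j ∈ T₁, ‖latticeFourier q Y (j - i)‖ ^ 2 = 0 := by
    have h1 : ((∑ i ∈ T₀, ∑ j ∈ T₁, ‖latticeFourier q Y (j - i)‖ ^ 2 : ℝ) : ℂ) = 0 := by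
      rw [hcross]
      push_cast
      refine Finset.sum_congr rfl fun i hi => Finset.sum_congr rfl fun j hj => ?_
      rw [hentry Y lam₂ i hi j hj, latticeFourier_neg hY, Complex.conj_mul']
    exact_mod_cast h1
  have h0 : (0 : (j : Fin d) → ZMod (q j)) ∈ T₀ := (hmem₀ 0).2 ⟨rfl, rfl, rfl⟩
  have h1 : m ∈ T₁ := (hmem₁ m).2 ⟨rfl, rfl, rfl⟩
  have h2 := (Finset.sum_eq_zero_iff_of_nonneg fun i _ =>
    Finset.sum_nonneg fun j _ => sq_nonneg _).1 hnorm 0 h0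
  have h3 := (Finset.sum_eq_zero_iff_of_nonneg fun j _ => sq_nonneg _).1 h2 m h1
  simpa using h3

/-! ### Separability in terms of Fourier coefficients -/

theorem latticeFourier_eq_zero_of_blockSeparable {c : Composition d} {V : (Fin d → ℤ) → ℂ}
    (hV : BlockSeparable c V) {s t : Fin d} (hst : c.index s ≠ c.index t)
    {m : (j : Fin d) → ZMod (q j)} (hs : m s ≠ 0) (ht : m t ≠ 0) : latticeFourier q V m = 0 := by
  obtain ⟨U, hU⟩ := hV
  have hindep : ∀ (i : Fin c.length) (a : Fin d), c.index a ≠ i → m a ≠ 0 →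
      ∑ n, U i (cellPoint q n ∘ c.embedding i) * latticeChar (-m) n = 0 := by
    intro i a ha hma
    refine sum_mul_latticeChar_eq_zero (s := a) (fun n => ?_) (by simpa using hma)
    congr 1
    funext b
    have hb : c.embedding i b ≠ a := by
      rintro rfl
      exact ha (c.index_embedding i b)
    simp [cellPoint, Pi.single_eq_of_ne hb]
  rw [latticeFourier]
  simp_rw [hU, Finset.sum_mul]
  rw [Finset.sum_comm, Finset.sum_eq_zero, mul_zero]
  intro i _
  by_cases hi : c.index s = i
  · exact hindep i t (fun h => hst (hi.trans h.symm)) ht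
  · exact hindep i s hi hs

theorem GammaPeriodic.apply_cellPoint {V : (Fin d → ℤ) → ℂ} (hV : GammaPeriodic q V)
    (n : Fin d → ℤ) : V (cellPoint q fun j => (n j : ZMod (q j))) = V n := by
  have hzmul : ∀ (j : Fin d) (a : ℤ) (n : Fin d → ℤ), V (n + Pi.single j (a * q j)) = V n := by
    intro j a
    induction a using Int.induction_on with
    | zero => simp
    | succ a ih =>
      intro n
      rw [add_mul, one_mul, Pi.single_add, ← add_assoc, hV, ih]
    | pred a ih =>
      intro n
      rw [← hV j, sub_mul, one_mul, Pi.single_sub, add_assoc, sub_add_cancel, ih]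
  have hsum : ∀ (T : Finset (Fin d)) (a : Fin d → ℤ) (n : Fin d → ℤ),
      V (n + ∑ j ∈ T, Pi.single j (a j * q j)) = V n := by
    intro T a
    induction T using Finset.induction_on with
    | empty => simp
    | insert b T hb ih =>
      intro n
      rw [Finset.sum_insert hb, ← add_assoc, ih, hzmul]
  have hn : n = cellPoint q (fun j => (n j : ZMod (q j))) +
      ∑ j, Pi.single j (n j / (q j : ℤ) * q j) := by
    rw [Finset.univ_sum_single]
    funext j
    simp only [cellPoint, Pi.add_apply, ZMod.val_intCast]
    exact (Int.emod_add_ediv_mul (n j) (q j)).symm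
  conv_rhs => rw [hn]
  rw [hsum]

/-- Each frequency in the Fourier expansion is supported in a single block of coordinates, so that
its character depends on the coordinates in this block only; `U i` collects the frequencies
assigned to the block `i`. -/
theorem blockSeparable_of_latticeFourier_eq_zero {c : Composition d} (hc : 0 < c.length)
    {V : (Fin d → ℤ) → ℂ} (hV : GammaPeriodic q V)
    (h : ∀ m : (j : Fin d) → ZMod (q j), ∀ s t : Fin d, c.index s ≠ c.index t → m s ≠ 0 →
      m t ≠ 0 → latticeFourier q V m = 0) : BlockSeparable c V := by
  classical
  have hblock : ∀ m : (j : Fin d) → ZMod (q j), ∃ i : Fin c.length,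
      latticeFourier q V m ≠ 0 → ∀ j, m j ≠ 0 → c.index j = i := by
    intro m
    by_cases hm : ∃ s, m s ≠ 0
    · obtain ⟨s, hs⟩ := hm
      refine ⟨c.index s, fun hne j hj => ?_⟩
      by_contra hjs
      exact hne (h m j s hjs hj hs)
    · push Not at hm
      exact ⟨⟨0, hc⟩, fun _ j hj => absurd (hm j) hj⟩
  choose ι hι using hblock
  refine ⟨fun i y => ∑ m, if ι m = i then latticeFourier q V m *
    ∏ b, (ZMod.stdAddChar (m (c.embedding i b) * (y b : ZMod (q (c.embedding i b)))) : ℂ) else 0,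
    fun n => ?_⟩
  rw [← hV.apply_cellPoint, ← sum_latticeFourier_mul V, Finset.sum_comm]
  refine Finset.sum_congr rfl fun m _ => ?_
  rw [Finset.sum_ite_eq, if_pos (Finset.mem_univ _)]
  by_cases hm : latticeFourier q V m = 0
  · simp [hm]
  congr 1
  rw [latticeChar]
  symm
  refine Finset.prod_of_injOn (c.embedding (ι m)) (c.embedding (ι m)).injective.injOn
    (fun _ _ => Finset.mem_coe.2 (Finset.mem_univ _)) (fun j _ hj => ?_) fun b _ => rfl
  have hj0 : m j = 0 := by
    by_contra hne
    have := (c.mem_range_embedding_iff').2 (hι m hm j hne).symm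
    exact hj (by simpa using this)
  simp [hj0]

end
end

theorem theorem3p5 (d : ℕ) (hd : 3 ≤ d) (q : Fin d → ℕ) [∀ j, NeZero (q j)]
    (hq : ∀ i j : Fin d, i ≠ j → Nat.Coprime (q i) (q j))
    (c : Composition d) (hr : 2 ≤ c.length)
    (V Y : (Fin d → ℤ) → ℂ)
    (hVreal : ∀ n, (V n).im = 0) (hYreal : ∀ n, (Y n).im = 0)
    (hVper : GammaPeriodic q V) (hYper : GammaPeriodic q Y)
    (hVsep : BlockSeparable c V)
    (hiso : ∀ i m : Fin c.length, i < m →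
      ∀ s ∈ Set.range (c.embedding i), ∀ t ∈ Set.range (c.embedding m),
        ∃ (lam₁ lam₂ : ℂ) (S : Finset (Fin d)), s ∈ S ∧ t ∈ S ∧ 3 ≤ S.card ∧
          GenPartiallyFermiIsospectral q V Y lam₁ lam₂ S) :
    BlockSeparable c Y := by
  refine blockSeparable_of_latticeFourier_eq_zero (q := q) (by omega) hYper fun m a b hab ha hb => ?_
  have key : ∀ s t : Fin d, c.index s < c.index t → m s ≠ 0 → m t ≠ 0 →
      latticeFourier q Y m = 0 := by
    intro s t hst hs ht
    obtain ⟨lam₁, lam₂, S, hsS, htS, hS, hiso'⟩ := hiso _ _ hst s (c.mem_range_embedding s) t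
      (c.mem_range_embedding t)
    have hne : s ≠ t := by
      rintro rfl
      exact lt_irrefl _ hst
    obtain ⟨u, hu⟩ : ((S.erase s).erase t).Nonempty := by
      rw [← Finset.card_pos, Finset.card_erase_of_mem (Finset.mem_erase.2 ⟨hne.symm, htS⟩),
        Finset.card_erase_of_mem hsS]
      omega
    simp only [Finset.mem_erase] at hu
    exact latticeFourier_eq_zero_of_isospectral hq hYreal hiso' hsS htS hu.2.2 hne hu.1.symm
      hu.2.1.symm
      (fun m' hs' ht' => latticeFourier_eq_zero_of_blockSeparable hVsep hst.ne hs' ht') hs ht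
  rcases lt_or_gt_of_ne hab with h | h
  · exact key a b h ha hb
  · exact key b a h hb ha
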